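/- Let $X$ be a (real) AM-space, i.e. a Banach lattice with $\|x\vee y\|=\max\{\|x\|,\|y\|\}$ for all $x,y\ge 0$. Let $K_X$ be the set of lattice homomorphisms $x^*\colon X\to\mathbb R$ with $\|x^*\|\le 1$, equipped with the weak$^*$ topology (a compact Hausdorff space), and put $K_X^*=K_X\setminus\{0\}$, $K_X^1=\{x^*\in K_X:\|x^*\|=1\}$. Let $C_{ph}(K_X)$ be the space of continuous functions $f\colon K_X\to\mathbb R$ that are positively homogeneous (that is, $f(\lambda x^*)=\lambda f(x^*)$ whenever $\lambda\ge 0$ and $x^*,\lambda x^*\in K_X$), with the pointwise order and the supremum norm. Let $\mathcal Z(C_{ph}(K_X))$ be its center: the algebra of all bounded linear operators $T$ on $C_{ph}(K_X)$ such that $\pm T\le \lambda I$ for some $\lambda>0$, ordered by $S\le T$ iff $Sf\le Tf$ for all $f\ge0$, with the operator norm. Let $A$ be the space of bounded continuous functions $h\colon K_X^*\to\mathbb R$ with $h(\lambda x^*)=h(x^*)$ for all $x^*\in K_X^1$ and $0<\lambda\le 1$, with pointwise operations and order and the supremum norm. For $h\in A$ let $M_h$ be the operator on $C_{ph}(K_X)$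 given by $(M_hf)(x^*)=h(x^*)f(x^*)$ for $x^*\in K_X^*$ and $(M_hf)(0)=0$. Then the map $M\colon A\to\mathcal Z(C_{ph}(K_X))$, $h\mapsto M_h$, is a surjective lattice-algebra isometry. That is, $M$ is a bijective unital algebra homomorphism; $h\le k$ if and only if $M_h\le M_k$; $M_{h\vee k}$ and $M_{h\wedge k}$ are the supremum and the infimum of $M_h$ and $M_k$ in $\mathcal Z(C_{ph}(K_X))$; and $\|M_h\|=\|h\|_\infty=\inf\{\lambda>0:\pm M_h\le\lambda I\}$ for all $h,k\in A$. -/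

import Mathlib

open scoped BoundedContinuousFunction

noncomputable section

namespace AMCenter

section General

/-- A Banach lattice `X` (the Banach lattice structure is given by the type classes wherever this
is used) is an *AM-space* if `‖x ∨ y‖ = max ‖x‖ ‖y‖` for all positive `x`, `y`. -/
def IsAMSpace (X : Type*) [NormedAddCommGroup X] [Lattice X] : Prop :=
  ∀ x y : X, 0 ≤ x → 0 ≤ y → ‖x ⊔ y‖ = max ‖x‖ ‖y‖

variable {E : Type*} [NormedAddCommGroup E] [NormedSpace ℝ E] [Lattice E]

/-- The usual order between bounded operators on an ordered space: `S f ≤ T f` for all `f ≥ 0`. -/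
def OpLE (S T : E →L[ℝ] E) : Prop := ∀ f : E, 0 ≤ f → S f ≤ T f

variable [IsOrderedAddMonoid E] [IsOrderedModule ℝ E]

variable (E) in
/-- The center `Z(E) = {T ∈ L(E) : ± T ≤ c I for some c > 0}`, with its algebra structure
(composition of operators). -/
def center : Subalgebra ℝ (E →L[ℝ] E) where
  carrier := {T | ∃ c : ℝ, 0 < c ∧ OpLE T (c • 1) ∧ OpLE (-T) (c • 1)}
  mul_mem' := by
    rintro S T ⟨a, ha, hS, hS'⟩ ⟨b, hb, hT, hT'⟩
    have key : ∀ f : E, 0 ≤ f → ∀ g : E, g ≤ b • f → -g ≤ b • f →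
        S g ≤ (3 * a * b) • f := by
      intro f hf g h1 h2
      have e1 := hS' (b • f - g) (sub_nonneg.2 h1)
      have e2 := hS f hf
      simp only [neg_apply, map_sub, map_smul, smul_apply,
        one_apply_eq_self] at e1 e2
      have e3 : b • S f ≤ b • a • f := smul_le_smul_of_nonneg_left e2 hb.le
      have e4 : a • (-g) ≤ a • b • f := smul_le_smul_of_nonneg_left h2 ha.le
      have e5 : S g ≤ b • S f + a • (b • f - g) := by
        rw [smul_neg, sub_neg_eq_add] at e1
        rw [smul_sub, smul_comm a b f]
        exact neg_add_le_iff_le_add.1 e1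
      calc S g ≤ b • S f + a • (b • f - g) := e5
        _ = b • S f + (a • b • f + a • (-g)) := by rw [smul_sub, smul_neg, sub_eq_add_neg]
        _ ≤ b • a • f + (a • b • f + a • b • f) := by gcongr
        _ = (3 * a * b) • f := by module
    refine ⟨3 * a * b, by positivity, fun f hf => ?_, fun f hf => ?_⟩
    · exact key f hf (T f) (by simpa using hT f hf) (by simpa using hT' f hf)
    · have := key f hf (-(T f)) (by simpa using hT' f hf) (by simpa using hT f hf)
      simpa using this
  add_mem' := by
    rintro S T ⟨a, ha, hS, hS'⟩ ⟨b, hb, hT, hT'⟩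
    refine ⟨a + b, by positivity, fun f hf => ?_, fun f hf => ?_⟩
    · simpa [add_smul] using add_le_add (hS f hf) (hT f hf)
    · have := add_le_add (hS' f hf) (hT' f hf)
      simpa [add_smul, add_comm] using this
  algebraMap_mem' := by
    intro r
    have h (s : ℝ) (hs : s ≤ |r| + 1) (f : E) (hf : 0 ≤ f) : s • f ≤ (|r| + 1) • f :=
      smul_le_smul_of_nonneg_right hs hf
    refine ⟨|r| + 1, by positivity, fun f hf => ?_, fun f hf => ?_⟩
    · simpa [Algebra.algebraMap_eq_smul_one] using h r (by linarith [le_abs_self r]) f hf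
    · simpa [Algebra.algebraMap_eq_smul_one] using h (-r) (by linarith [neg_le_abs r]) f hf

/-- The center carries the order of operators. -/
instance : PartialOrder (center E) where
  le S T := OpLE (S : E →L[ℝ] E) T
  le_refl S f _ := le_rfl
  le_trans S T U h h' f hf := (h f hf).trans (h' f hf)
  le_antisymm S T h h' := by
    have hp (f : E) (hf : 0 ≤ f) : (S : E →L[ℝ] E) f = (T : E →L[ℝ] E) f :=
      le_antisymm (h f hf) (h' f hf)
    ext f
    rw [← posPart_sub_negPart f, map_sub, map_sub, hp _ (posPart_nonneg f),
      hp _ (negPart_nonneg f)]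

end General

section KX

variable (X : Type*) [NormedAddCommGroup X] [NormedSpace ℝ X] [Lattice X]

/-- `K_X = hom(X, ℝ) ∩ B_{X^*}`, the set of lattice homomorphisms `X → ℝ` in the closed dual unit
ball, with the weak-* topology. -/
def KX : Set (WeakDual ℝ X) :=
  {φ | (∀ x y : X, φ (x ⊔ y) = φ x ⊔ φ y) ∧ (∀ x y : X, φ (x ⊓ y) = φ x ⊓ φ y) ∧
    ‖WeakDual.toStrongDual φ‖ ≤ 1}

/-- `K_X^* = K_X \ {0}`. -/
def KXstar : Set (WeakDual ℝ X) := KX X \ {0}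

/-- `K_X^1`, the elements of `K_X` of norm one. -/
def KXone : Set (WeakDual ℝ X) := {φ ∈ KX X | ‖WeakDual.toStrongDual φ‖ = 1}

theorem isCompact_KX : IsCompact (KX X) := by
  have h : KX X = (WeakDual.toStrongDual ⁻¹' Metric.closedBall (0 : StrongDual ℝ X) 1) ∩
      ({φ : WeakDual ℝ X | ∀ x y : X, φ (x ⊔ y) = φ x ⊔ φ y} ∩
        {φ : WeakDual ℝ X | ∀ x y : X, φ (x ⊓ y) = φ x ⊓ φ y}) := by
    ext φ
    simp only [KX, Set.mem_ofPred_eq, Set.mem_inter_iff, Set.mem_preimage, mem_closedBall_zero_iff]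
    tauto
  rw [h]
  refine (WeakDual.isCompact_closedBall 0 1).inter_right (IsClosed.inter ?_ ?_)
  · simp only [Set.ofPred_forall]
    exact isClosed_iInter fun x => isClosed_iInter fun y => isClosed_eq
      (WeakDual.eval_continuous _) ((WeakDual.eval_continuous _).sup (WeakDual.eval_continuous _))
  · simp only [Set.ofPred_forall]
    exact isClosed_iInter fun x => isClosed_iInter fun y => isClosed_eq
      (WeakDual.eval_continuous _) ((WeakDual.eval_continuous _).inf (WeakDual.eval_continuous _))

instance : CompactSpace (KX X) := isCompact_iff_compactSpace.1 (isCompact_KX X)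

/-- The space of continuous positively homogeneous functions on `K_X`, as a subspace of
`C(K_X, ℝ)`. -/
def cphSubmodule : Submodule ℝ C(KX X, ℝ) where
  carrier := {f | ∀ (φ ψ : KX X) (c : ℝ), 0 ≤ c → (ψ : WeakDual ℝ X) = c • (φ : WeakDual ℝ X) →
    f ψ = c * f φ}
  add_mem' := by
    intro f g hf hg φ ψ c hc h
    simp [hf φ ψ c hc h, hg φ ψ c hc h, mul_add]
  zero_mem' := by
    intro φ ψ c _ _
    simp
  smul_mem' := by
    intro r f hf φ ψ c hc h
    simp [hf φ ψ c hc h, mul_left_comm]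

/-- `C_ph(K_X)`: the normed space of continuous positively homogeneous functions on `K_X`, with
the supremum norm (inherited from `C(K_X, ℝ)`). -/
def Cph : Type _ := cphSubmodule X

instance : NormedAddCommGroup (Cph X) := inferInstanceAs (NormedAddCommGroup (cphSubmodule X))

instance : NormedSpace ℝ (Cph X) := inferInstanceAs (NormedSpace ℝ (cphSubmodule X))

/-- The pointwise lattice structure of `C_ph(K_X)`. -/
instance : Lattice (Cph X) :=
  Subtype.lattice (P := fun f => f ∈ cphSubmodule X)
    (fun f g hf hg φ ψ c hc h => by
      simp [hf φ ψ c hc h, hg φ ψ c hc h, mul_max_of_nonneg _ _ hc])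
    (fun f g hf hg φ ψ c hc h => by
      simp [hf φ ψ c hc h, hg φ ψ c hc h, mul_min_of_nonneg _ _ hc])

variable {X} in
theorem cph_le_iff (f g : Cph X) : f ≤ g ↔ ∀ φ, f.1 φ ≤ g.1 φ :=
  Iff.rfl

instance : IsOrderedAddMonoid (Cph X) where
  add_le_add_left f g h k φ := by
    exact add_le_add_left (h φ) (k.1 φ)

instance : IsOrderedModule ℝ (Cph X) where
  smul_le_smul_of_nonneg_left _ hc _ _ h φ :=
    mul_le_mul_of_nonneg_left (h φ) hc
  smul_le_smul_of_nonneg_right _ hf _ _ h φ :=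
    mul_le_mul_of_nonneg_right h (hf φ)

/-- The bounded continuous functions `h` on `K_X^*` such that `h (λ φ) = h φ` for all
`φ ∈ K_X^1` and `0 < λ ≤ 1`, with the supremum norm and the pointwise operations. -/
def czero : Subalgebra ℝ (KXstar X →ᵇ ℝ) where
  carrier := {h | ∀ φ ψ : KXstar X, (φ : WeakDual ℝ X) ∈ KXone X → ∀ c : ℝ, 0 < c → c ≤ 1 →
    (ψ : WeakDual ℝ X) = c • (φ : WeakDual ℝ X) → h ψ = h φ}
  mul_mem' := by
    intro f g hf hg φ ψ h1 c h0 hc h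
    simp [hf φ ψ h1 c h0 hc h, hg φ ψ h1 c h0 hc h]
  add_mem' := by
    intro f g hf hg φ ψ h1 c h0 hc h
    simp [hf φ ψ h1 c h0 hc h, hg φ ψ h1 c h0 hc h]
  algebraMap_mem' := by
    intro r φ ψ h1 c h0 hc h
    rfl

/-- The pointwise lattice structure of `czero X`. -/
instance : Lattice (czero X) :=
  Subtype.lattice
    (fun f g hf hg φ ψ h1 c h0 hc h => by
      simp [hf φ ψ h1 c h0 hc h, hg φ ψ h1 c h0 hc h])
    (fun f g hf hg φ ψ h1 c h0 hc h => by
      simp [hf φ ψ h1 c h0 hc h, hg φ ψ h1 c h0 hc h])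

variable {X}

theorem smul_mem_KX {φ : WeakDual ℝ X} (hφ : φ ∈ KX X) {c : ℝ} (hc : 0 ≤ c)
    (h : ‖WeakDual.toStrongDual (c • φ)‖ ≤ 1) : c • φ ∈ KX X := by
  refine ⟨fun x y => ?_, fun x y => ?_, h⟩
  · change c * φ (x ⊔ y) = (c * φ x) ⊔ (c * φ y)
    rw [hφ.1]; exact mul_max_of_nonneg _ _ hc
  · change c * φ (x ⊓ y) = (c * φ x) ⊓ (c * φ y)
    rw [hφ.2.1]; exact mul_min_of_nonneg _ _ hc

/-- Elements of `czero X` are constant along rays, not only on rays starting in `K_X^1`. -/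
theorem czero_apply_eq (h : czero X) (φ ψ : KXstar X) (c : ℝ) (hc : 0 < c)
    (e : (ψ : WeakDual ℝ X) = c • (φ : WeakDual ℝ X)) : h.1 ψ = h.1 φ := by
  have norm_pos (χ : KXstar X) : 0 < ‖WeakDual.toStrongDual (χ : WeakDual ℝ X)‖ := by
    rw [norm_pos_iff]
    exact fun h0 => χ.2.2 (WeakDual.toStrongDual.injective (by simpa using h0))
  have hφ := norm_pos φ
  set n := ‖WeakDual.toStrongDual (φ : WeakDual ℝ X)‖ with hn
  have h1 : ‖WeakDual.toStrongDual (n⁻¹ • (φ : WeakDual ℝ X))‖ = 1 := by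
    rw [map_smul, norm_smul, ← hn, norm_inv, Real.norm_of_nonneg hφ.le]
    exact inv_mul_cancel₀ hφ.ne'
  have h2 : n⁻¹ • (φ : WeakDual ℝ X) ∈ KX X :=
    smul_mem_KX φ.2.1 (inv_nonneg.2 hφ.le) h1.le
  have h3 : n⁻¹ • (φ : WeakDual ℝ X) ≠ 0 := smul_ne_zero (inv_ne_zero hφ.ne') φ.2.2
  let χ : KXstar X := ⟨n⁻¹ • (φ : WeakDual ℝ X), h2, h3⟩
  have hψ : ‖WeakDual.toStrongDual (ψ : WeakDual ℝ X)‖ = c * n := by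
    rw [e, map_smul, norm_smul, Real.norm_of_nonneg hc.le]
  rw [h.2 χ φ ⟨h2, h1⟩ n hφ φ.2.1.2.2 (by simp [χ, smul_smul, hφ.ne']),
    h.2 χ ψ ⟨h2, h1⟩ (c * n) (by positivity) (hψ ▸ ψ.2.1.2.2)
      (by simp [χ, smul_smul, hφ.ne', e])]

open Classical in
/-- The function `M_h(f)`: it is `h · f` on `K_X^*` and `0` at the point `0`. -/
def mulFun (h : czero X) (f : Cph X) (φ : KX X) : ℝ :=
  if h0 : (φ : WeakDual ℝ X) = 0 then 0 else h.1 ⟨φ, φ.2, h0⟩ * f.1 φ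

theorem cph_apply_zero (f : Cph X) (φ : KX X) (h0 : (φ : WeakDual ℝ X) = 0) : f.1 φ = 0 := by
  have := f.2 φ φ 0 le_rfl (by simp [h0])
  simpa using this

theorem abs_mulFun_le (h : czero X) (f : Cph X) (φ : KX X) :
    |mulFun h f φ| ≤ ‖h‖ * |f.1 φ| := by
  unfold mulFun
  split_ifs with h0
  · simp only [abs_zero]; positivity
  · rw [abs_mul]
    exact mul_le_mul_of_nonneg_right (h.1.norm_coe_le_norm _) (abs_nonneg _)

theorem continuous_mulFun (h : czero X) (f : Cph X) : Continuous (mulFun h f) := by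
  rw [continuous_iff_continuousAt]
  intro φ
  by_cases h0 : (φ : WeakDual ℝ X) = 0
  · have e : mulFun h f φ = 0 := by simp [mulFun, h0]
    rw [ContinuousAt, e]
    refine squeeze_zero_norm (fun ψ => abs_mulFun_le h f ψ) ?_
    have hc : Continuous fun ψ : KX X => ‖h‖ * |f.1 ψ| := by fun_prop
    have := hc.tendsto φ
    simpa [cph_apply_zero f φ h0] using this
  · let U : Set (KX X) := {ψ | (ψ : WeakDual ℝ X) ≠ 0}
    have hU : IsOpen U := isOpen_ne_fun continuous_subtype_val continuous_const
    have hon : ContinuousOn (mulFun h f) U := by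
      rw [continuousOn_iff_continuous_domRestrict]
      have : U.domRestrict (mulFun h f) =
          fun ψ : U => h.1 ⟨ψ.1.1, ψ.1.2, ψ.2⟩ * f.1 ψ.1 := by
        ext ψ
        have : (ψ.1 : WeakDual ℝ X) ≠ 0 := ψ.2
        simp [mulFun, this]
      rw [this]
      have hi : Continuous fun ψ : U => (⟨ψ.1.1, ψ.1.2, ψ.2⟩ : KXstar X) :=
        Continuous.subtype_mk (continuous_subtype_val.comp continuous_subtype_val) _
      exact (h.1.continuous.comp hi).mul (f.1.continuous.comp continuous_subtype_val)
    exact hon.continuousAt (hU.mem_nhds h0)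

theorem mulFun_homogeneous (h : czero X) (f : Cph X) (φ ψ : KX X) (c : ℝ) (hc : 0 ≤ c)
    (e : (ψ : WeakDual ℝ X) = c • (φ : WeakDual ℝ X)) :
    mulFun h f ψ = c * mulFun h f φ := by
  by_cases hφ : (φ : WeakDual ℝ X) = 0
  · have hψ : (ψ : WeakDual ℝ X) = 0 := by simp [e, hφ]
    simp [mulFun, hφ, hψ]
  · rcases hc.eq_or_lt with rfl | hc
    · have hψ : (ψ : WeakDual ℝ X) = 0 := by simp [e]
      simp [mulFun, hψ]
    · have hψ : (ψ : WeakDual ℝ X) ≠ 0 := by rw [e]; exact smul_ne_zero hc.ne' hφ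
      have h1 := czero_apply_eq h ⟨φ, φ.2, hφ⟩ ⟨ψ, ψ.2, hψ⟩ c hc e
      simp only [mulFun, hφ, hψ, dite_false, h1, f.2 φ ψ c hc.le e]
      ring

/-- The operator `M_h : C_ph(K_X) → C_ph(K_X)` of multiplication by `h`. -/
def mulOp (h : czero X) : Cph X →L[ℝ] Cph X :=
  LinearMap.mkContinuous
    { toFun := fun f => ⟨⟨mulFun h f, continuous_mulFun h f⟩, mulFun_homogeneous h f⟩
      map_add' := fun f g => by
        refine Subtype.ext (ContinuousMap.ext fun φ => ?_)
        change mulFun h (f + g) φ = mulFun h f φ + mulFun h g φ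
        unfold mulFun
        split_ifs
        · simp
        · exact mul_add _ _ _
      map_smul' := fun r f => by
        refine Subtype.ext (ContinuousMap.ext fun φ => ?_)
        change mulFun h (r • f) φ = r * mulFun h f φ
        unfold mulFun
        split_ifs
        · simp
        · exact mul_left_comm _ _ _ }
    ‖h‖ (fun f => by
      refine (ContinuousMap.norm_le _ (by positivity)).2 fun φ => ?_
      refine (abs_mulFun_le h f φ).trans ?_
      exact mul_le_mul_of_nonneg_left (f.1.norm_coe_le_norm φ) (norm_nonneg h.1))

end KX

end AMCenter

end

open scoped BoundedContinuousFunction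

noncomputable section

namespace AMCenter

variable {X : Type*} [NormedAddCommGroup X] [NormedSpace ℝ X] [Lattice X]

/-! Two facts carry the proof. Every nonzero point `φ` admits `f ≥ 0` in `Cph X` with `f φ > 0`,
namely the modulus of an evaluation at some `x` (`exists_nonneg_apply_pos`). Every central `T`
satisfies `|T f| ≤ c |f|` pointwise (`abs_apply_le_of_opLE`), so `T f` vanishes wherever `f` does.
Hence `T f φ` depends only on `f φ`, and `T` is multiplication by the function `T f φ / f φ`, which
is bounded by `c`, locally a quotient of continuous functions, and constant along rays
(`exists_mulOp_eq`).

The order statements follow by cancelling `f φ > 0`. For the norm, testing `M_h` on evaluations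
bounds `|h|` at functionals of norm one, which suffices because `h` is constant along rays
(`norm_mulOp`). -/

/-- The evaluation at `x`, as an element of `Cph X`. -/
def evalCph (x : X) : Cph X :=
  ⟨⟨fun φ => (φ : WeakDual ℝ X) x, (WeakDual.eval_continuous x).comp continuous_subtype_val⟩,
    fun φ ψ c _ e => by
      change (ψ : WeakDual ℝ X) x = c * (φ : WeakDual ℝ X) x
      rw [e]; rfl⟩

theorem evalCph_apply (x : X) (φ : KX X) : (evalCph x).1 φ = (φ : WeakDual ℝ X) x := rfl

theorem norm_evalCph_le (x : X) : ‖evalCph x‖ ≤ ‖x‖ := by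
  refine (ContinuousMap.norm_le _ (norm_nonneg x)).2 fun φ => ?_
  have := (WeakDual.toStrongDual (φ : WeakDual ℝ X)).le_of_opNorm_le φ.2.2.2 x
  rwa [one_mul] at this

theorem abs_apply_le_norm (f : Cph X) (φ : KX X) : |f.1 φ| ≤ ‖f‖ :=
  f.1.norm_coe_le_norm φ

theorem exists_evalCph_ne_zero {φ : KX X} (hφ : (φ : WeakDual ℝ X) ≠ 0) :
    ∃ x : X, (evalCph x).1 φ ≠ 0 := by
  by_contra! h
  exact hφ (DFunLike.ext _ _ h)

theorem cph_ext {f g : Cph X} (h : ∀ φ, f.1 φ = g.1 φ) : f = g :=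
  Subtype.ext (ContinuousMap.ext h)

theorem abs_apply (f : Cph X) (φ : KX X) : |f|.1 φ = |f.1 φ| := rfl

theorem mulOp_apply_of_ne_zero (h : czero X) (f : Cph X) (φ : KXstar X) :
    (mulOp h f).1 ⟨φ.1, φ.2.1⟩ = h.1 φ * f.1 ⟨φ.1, φ.2.1⟩ :=
  dif_neg φ.2.2

theorem cph_ext_of_ne_zero {f g : Cph X}
    (h : ∀ φ : KXstar X, f.1 ⟨φ.1, φ.2.1⟩ = g.1 ⟨φ.1, φ.2.1⟩) : f = g := by
  refine cph_ext fun φ => ?_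
  by_cases h0 : (φ : WeakDual ℝ X) = 0
  · rw [cph_apply_zero f φ h0, cph_apply_zero g φ h0]
  · exact h ⟨φ.1, φ.2, h0⟩

theorem cph_le_of_ne_zero {f g : Cph X}
    (h : ∀ φ : KXstar X, f.1 ⟨φ.1, φ.2.1⟩ ≤ g.1 ⟨φ.1, φ.2.1⟩) : f ≤ g := by
  refine (cph_le_iff f g).2 fun φ => ?_
  by_cases h0 : (φ : WeakDual ℝ X) = 0
  · rw [cph_apply_zero f φ h0, cph_apply_zero g φ h0]
  · exact h ⟨φ.1, φ.2, h0⟩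

/-! ### Multiplication operators: algebra, order and norm. -/

theorem czero_le_iff (h k : czero X) : h ≤ k ↔ ∀ φ, h.1 φ ≤ k.1 φ := Iff.rfl

theorem opLE_mulOp_smul_one {h : czero X} {c : ℝ} (hc : ‖h‖ ≤ c) :
    OpLE (mulOp h) (c • 1) := by
  intro f hf
  refine cph_le_of_ne_zero fun φ => ?_
  rw [mulOp_apply_of_ne_zero]
  exact mul_le_mul_of_nonneg_right ((le_abs_self _).trans ((h.1.norm_coe_le_norm φ).trans hc))
    (hf _)

/-- `h ↦ M_h` as a linear map into the bounded operators. -/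
def mulOpLinear : czero X →ₗ[ℝ] (Cph X →L[ℝ] Cph X) where
  toFun := mulOp
  map_add' h k := by
    ext1 f
    refine cph_ext_of_ne_zero fun φ => ?_
    change _ = (mulOp h f).1 _ + (mulOp k f).1 _
    simp only [mulOp_apply_of_ne_zero]
    exact add_mul _ _ _
  map_smul' r h := by
    ext1 f
    refine cph_ext_of_ne_zero fun φ => ?_
    change _ = r * (mulOp h f).1 _
    simp only [mulOp_apply_of_ne_zero]
    exact mul_assoc _ _ _

/-- `h ↦ M_h` as an algebra homomorphism into the bounded operators. -/
def mulOpAlgHom : czero X →ₐ[ℝ] (Cph X →L[ℝ] Cph X) :=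
  AlgHom.ofLinearMap mulOpLinear
    (by
      ext1 f
      refine cph_ext_of_ne_zero fun φ => ?_
      exact (mulOp_apply_of_ne_zero 1 f φ).trans (one_mul _))
    (fun h k => by
      ext1 f
      refine cph_ext_of_ne_zero fun φ => ?_
      change (mulOp (h * k) f).1 _ = (mulOp h (mulOp k f)).1 _
      simp only [mulOp_apply_of_ne_zero]
      exact mul_assoc _ _ _)

theorem mulOp_neg (h : czero X) : mulOp (-h) = -mulOp h := map_neg mulOpLinear h

theorem opLE_neg_mulOp_smul_one {h : czero X} {c : ℝ} (hc : ‖h‖ ≤ c) :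
    OpLE (-mulOp h) (c • 1) := by
  rw [← mulOp_neg]
  exact opLE_mulOp_smul_one ((norm_neg h.1).trans_le hc)

theorem mulOp_mem_center (h : czero X) : mulOp h ∈ center (Cph X) :=
  ⟨‖h‖ + 1, by positivity, opLE_mulOp_smul_one (by linarith),
    opLE_neg_mulOp_smul_one (by linarith)⟩

theorem exists_nonneg_apply_pos (φ : KXstar X) :
    ∃ f : Cph X, 0 ≤ f ∧ 0 < f.1 ⟨φ.1, φ.2.1⟩ := by
  obtain ⟨x, hx⟩ := exists_evalCph_ne_zero (φ := ⟨φ.1, φ.2.1⟩) φ.2.2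
  exact ⟨|evalCph x|, abs_nonneg _, by rw [abs_apply]; exact abs_pos.2 hx⟩

theorem opLE_mulOp_iff (h k : czero X) : OpLE (mulOp h) (mulOp k) ↔ h ≤ k := by
  refine ⟨fun H => (czero_le_iff h k).2 fun φ => ?_, fun H f hf => cph_le_of_ne_zero fun φ => ?_⟩
  · obtain ⟨f, hf, hp⟩ := exists_nonneg_apply_pos φ
    have := (cph_le_iff _ _).1 (H f hf) ⟨φ.1, φ.2.1⟩
    rw [mulOp_apply_of_ne_zero, mulOp_apply_of_ne_zero] at this
    exact le_of_mul_le_mul_right this hp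
  · rw [mulOp_apply_of_ne_zero, mulOp_apply_of_ne_zero]
    exact mul_le_mul_of_nonneg_right (H φ) (hf _)

theorem apply_le_of_opLE_smul_one {h : czero X} {c : ℝ} (H : OpLE (mulOp h) (c • 1))
    (φ : KXstar X) : h.1 φ ≤ c := by
  obtain ⟨f, hf, hp⟩ := exists_nonneg_apply_pos φ
  have := (cph_le_iff _ _).1 (H f hf) ⟨φ.1, φ.2.1⟩
  rw [mulOp_apply_of_ne_zero] at this
  exact le_of_mul_le_mul_right this hp

theorem norm_le_of_opLE {h : czero X} {c : ℝ} (hc : 0 ≤ c) (H : OpLE (mulOp h) (c • 1))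
    (H' : OpLE (-mulOp h) (c • 1)) : ‖h‖ ≤ c := by
  refine (BoundedContinuousFunction.norm_le (f := h.1) hc).2 fun φ => abs_le'.2
    ⟨apply_le_of_opLE_smul_one H φ, ?_⟩
  rw [← mulOp_neg] at H'
  exact apply_le_of_opLE_smul_one H' φ

theorem norm_mulOp (h : czero X) : ‖mulOp h‖ = ‖h‖ := by
  refine le_antisymm (LinearMap.mkContinuous_norm_le _ (norm_nonneg h.1) _) ?_
  refine (BoundedContinuousFunction.norm_le (f := h.1) (norm_nonneg _)).2 fun φ => ?_
  -- `|h χ| ‖χ‖ ≤ ‖M_h‖` for every `χ`; apply this to the normalization of `φ`.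
  set n := ‖WeakDual.toStrongDual (φ : WeakDual ℝ X)‖ with hn
  have hn0 : 0 < n := by
    rw [hn, norm_pos_iff]
    exact fun h0 => φ.2.2 (WeakDual.toStrongDual.injective (by simpa using h0))
  have h1 : ‖WeakDual.toStrongDual (n⁻¹ • (φ : WeakDual ℝ X))‖ = 1 := by
    rw [map_smul, norm_smul, ← hn, norm_inv, Real.norm_of_nonneg hn0.le]
    exact inv_mul_cancel₀ hn0.ne'
  let χ : KXstar X := ⟨n⁻¹ • (φ : WeakDual ℝ X), smul_mem_KX φ.2.1 (inv_nonneg.2 hn0.le) h1.le,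
    smul_ne_zero (inv_ne_zero hn0.ne') φ.2.2⟩
  rw [← czero_apply_eq h φ χ n⁻¹ (inv_pos.2 hn0) rfl]
  -- At `χ`, `M_h` sends the evaluation at `x` to `h χ * χ x`, and that evaluation has norm at most
  -- `‖x‖`.
  have key : ‖h.1 χ • WeakDual.toStrongDual (χ : WeakDual ℝ X)‖ ≤ ‖mulOp h‖ := by
    refine ContinuousLinearMap.opNorm_le_bound _ (norm_nonneg _) fun x => ?_
    calc ‖h.1 χ * (χ : WeakDual ℝ X) x‖
        = |(mulOp h (evalCph x)).1 ⟨χ.1, χ.2.1⟩| := by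
          rw [mulOp_apply_of_ne_zero, evalCph_apply, Real.norm_eq_abs]
      _ ≤ ‖mulOp h (evalCph x)‖ := abs_apply_le_norm _ _
      _ ≤ ‖mulOp h‖ * ‖x‖ := (mulOp h).le_opNorm_of_le (norm_evalCph_le x)
  rwa [norm_smul, h1, mul_one] at key

/-! ### Central operators are multiplications. -/

/-- A central operator satisfies `|T f| ≤ c |f|`. -/
theorem abs_apply_le_of_opLE {T : Cph X →L[ℝ] Cph X} {c : ℝ} (h : OpLE T (c • 1))
    (h' : OpLE (-T) (c • 1)) (f : Cph X) (φ : KX X) : |(T f).1 φ| ≤ c * |f.1 φ| := by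
  -- The order bounds only speak of positive functions; the general case splits `f` as `f⁺ - f⁻`,
  -- with `|f| = f⁺ + f⁻`.
  have key (g : Cph X) (hg : 0 ≤ g) : |(T g).1 φ| ≤ c * g.1 φ :=
    abs_le'.2 ⟨h g hg φ, h' g hg φ⟩
  have e : (T f).1 φ = (T f⁺).1 φ - (T f⁻).1 φ := by
    conv_lhs => rw [← posPart_sub_negPart f, map_sub]
    rfl
  have e' : f⁺.1 φ + f⁻.1 φ = |f.1 φ| := by
    rw [← abs_apply, ← posPart_add_negPart f]; rfl
  rw [e, ← e', mul_add]
  exact (abs_sub _ _).trans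
    (add_le_add (key _ (posPart_nonneg f)) (key _ (negPart_nonneg f)))

/-- With the values at `φ` as scalars, `g φ • f - f φ • g` vanishes at `φ`, hence so does its image
under `T`. -/
theorem apply_mul_apply_comm {T : Cph X →L[ℝ] Cph X} (hT : T ∈ center (Cph X)) (f g : Cph X)
    (φ : KX X) : (T f).1 φ * g.1 φ = (T g).1 φ * f.1 φ := by
  obtain ⟨c, -, h, h'⟩ := hT
  have e := abs_apply_le_of_opLE h h' (g.1 φ • f - f.1 φ • g) φ
  rw [map_sub, map_smul, map_smul] at e
  change |g.1 φ * (T f).1 φ - f.1 φ * (T g).1 φ| ≤ c * |g.1 φ * f.1 φ - f.1 φ * g.1 φ| at e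
  rw [mul_comm (g.1 φ) (f.1 φ), sub_self, abs_zero, mul_zero] at e
  linarith [abs_nonpos_iff.1 e]

/-- The multiplier of a central operator. -/
def multiplier (T : Cph X →L[ℝ] Cph X) (φ : KXstar X) : ℝ :=
  (T (exists_nonneg_apply_pos φ).choose).1 ⟨φ.1, φ.2.1⟩ /
    (exists_nonneg_apply_pos φ).choose.1 ⟨φ.1, φ.2.1⟩

/-- The quotient defining `multiplier` does not depend on the chosen function, by
`apply_mul_apply_comm`. -/
theorem multiplier_mul {T : Cph X →L[ℝ] Cph X} (hT : T ∈ center (Cph X)) (f : Cph X)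
    (φ : KXstar X) : multiplier T φ * f.1 ⟨φ.1, φ.2.1⟩ = (T f).1 ⟨φ.1, φ.2.1⟩ := by
  have hp := (exists_nonneg_apply_pos φ).choose_spec.2
  rw [multiplier, div_mul_eq_mul_div, div_eq_iff hp.ne']
  exact apply_mul_apply_comm hT _ _ _

theorem multiplier_eq_div {T : Cph X →L[ℝ] Cph X} (hT : T ∈ center (Cph X)) {f : Cph X}
    {φ : KXstar X} (hf : f.1 ⟨φ.1, φ.2.1⟩ ≠ 0) :
    multiplier T φ = (T f).1 ⟨φ.1, φ.2.1⟩ / f.1 ⟨φ.1, φ.2.1⟩ :=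
  eq_div_of_mul_eq hf (multiplier_mul hT f φ)

/-- The function chosen in `multiplier` varies arbitrarily with the point. A single `f` positive at
`φ` stays nonzero nearby, and there the multiplier is `T f / f`. -/
theorem continuous_multiplier {T : Cph X →L[ℝ] Cph X} (hT : T ∈ center (Cph X)) :
    Continuous (multiplier T) := by
  have hi : Continuous fun φ : KXstar X => (⟨φ.1, φ.2.1⟩ : KX X) :=
    continuous_subtype_val.subtype_mk _
  have hc (f : Cph X) : Continuous fun φ : KXstar X => f.1 ⟨φ.1, φ.2.1⟩ :=
    f.1.continuous.comp hi
  refine continuous_iff_continuousAt.2 fun φ => ?_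
  obtain ⟨f, -, hp⟩ := exists_nonneg_apply_pos φ
  refine ((hc (T f)).continuousAt.div (hc f).continuousAt hp.ne').congr ?_
  filter_upwards [(hc f).continuousAt.eventually_ne hp.ne'] with ψ hψ
  exact (multiplier_eq_div hT hψ).symm

theorem abs_multiplier_le {T : Cph X →L[ℝ] Cph X} {c : ℝ} (hc : 0 < c) (h : OpLE T (c • 1))
    (h' : OpLE (-T) (c • 1)) (φ : KXstar X) : |multiplier T φ| ≤ c := by
  obtain ⟨f, -, hp⟩ := exists_nonneg_apply_pos φ
  have e := abs_apply_le_of_opLE h h' f ⟨φ.1, φ.2.1⟩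
  rw [← multiplier_mul ⟨c, hc, h, h'⟩, abs_mul] at e
  exact le_of_mul_le_mul_right e (abs_pos.2 hp.ne')

/-- Both `T f` and `f` are homogeneous, so the factor `c` cancels in their quotient. -/
theorem multiplier_smul {T : Cph X →L[ℝ] Cph X} (hT : T ∈ center (Cph X)) {φ ψ : KXstar X}
    {c : ℝ} (hc : 0 < c) (e : (ψ : WeakDual ℝ X) = c • (φ : WeakDual ℝ X)) :
    multiplier T ψ = multiplier T φ := by
  obtain ⟨f, -, hp⟩ := exists_nonneg_apply_pos φ
  have h1 (g : Cph X) : g.1 ⟨ψ.1, ψ.2.1⟩ = c * g.1 ⟨φ.1, φ.2.1⟩ := g.2 _ _ c hc.le e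
  have h2 : f.1 ⟨ψ.1, ψ.2.1⟩ ≠ 0 := by
    rw [h1]; exact (mul_pos hc hp).ne'
  rw [multiplier_eq_div hT h2, multiplier_eq_div hT hp.ne', h1, h1,
    mul_div_mul_left _ _ hc.ne']

theorem exists_mulOp_eq {T : Cph X →L[ℝ] Cph X} (hT : T ∈ center (Cph X)) :
    ∃ h : czero X, mulOp h = T := by
  obtain ⟨c, hc, h, h'⟩ := id hT
  let m : KXstar X →ᵇ ℝ := BoundedContinuousFunction.ofNormedAddCommGroup (multiplier T)
    (continuous_multiplier hT) c (abs_multiplier_le hc h h')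
  refine ⟨⟨m, fun φ ψ _ r hr _ e => multiplier_smul hT hr e⟩, ?_⟩
  ext1 f
  refine cph_ext_of_ne_zero fun φ => ?_
  rw [mulOp_apply_of_ne_zero]
  exact multiplier_mul hT f φ

theorem mulOp_injective : Function.Injective (mulOp : czero X → Cph X →L[ℝ] Cph X) :=
  fun h k e => le_antisymm ((opLE_mulOp_iff h k).1 fun _ _ => by rw [e])
    ((opLE_mulOp_iff k h).1 fun _ _ => by rw [e])

variable (X) in
/-- The lattice-algebra isomorphism `h ↦ M_h` of `czero X` onto the center of `Cph X`. -/
def mulOpEquiv : czero X ≃ₐ[ℝ] center (Cph X) :=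
  AlgEquiv.ofBijective (mulOpAlgHom.codRestrict (center (Cph X)) mulOp_mem_center)
    ⟨fun _ _ e => mulOp_injective (congrArg Subtype.val e),
      fun T => (exists_mulOp_eq T.2).imp fun _ e => Subtype.ext e⟩

theorem coe_mulOpEquiv (h : czero X) :
    (mulOpEquiv X h : Cph X →L[ℝ] Cph X) = mulOp h := rfl

variable (X) in
/-- `mulOpEquiv` as an order isomorphism. -/
def mulOpOrderIso : czero X ≃o center (Cph X) where
  toEquiv := (mulOpEquiv X).toEquiv
  map_rel_iff' {h k} := opLE_mulOp_iff h k

theorem isGLB_setOf_opLE (h : czero X) :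
    IsGLB {c : ℝ | 0 < c ∧ OpLE (mulOp h) (c • 1) ∧ OpLE (-mulOp h) (c • 1)} ‖h‖ := by
  refine ⟨fun c hc => norm_le_of_opLE hc.1.le hc.2.1 hc.2.2, fun b hb => ?_⟩
  -- The slack `ε` is needed because `‖h‖` itself is not in the set when `h = 0`.
  refine le_of_forall_pos_le_add fun ε hε => hb ⟨by positivity, ?_, ?_⟩
  · exact opLE_mulOp_smul_one (by linarith)
  · exact opLE_neg_mulOp_smul_one (by linarith)

end AMCenter

end

theorem proposition2p2 (X : Type*) [NormedAddCommGroup X] [NormedSpace ℝ X] [CompleteSpace X]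
    [Lattice X] [IsOrderedAddMonoid X] [IsOrderedModule ℝ X] [HasSolidNorm X]
    (hX : AMCenter.IsAMSpace X) :
    ∃ Φ : AMCenter.czero X ≃ₐ[ℝ] AMCenter.center (AMCenter.Cph X),
      (∀ h : AMCenter.czero X, (Φ h : AMCenter.Cph X →L[ℝ] AMCenter.Cph X) = AMCenter.mulOp h) ∧
      (∀ h k : AMCenter.czero X, Φ h ≤ Φ k ↔ h ≤ k) ∧
      (∀ h k : AMCenter.czero X, IsLUB {Φ h, Φ k} (Φ (h ⊔ k)) ∧ IsGLB {Φ h, Φ k} (Φ (h ⊓ k))) ∧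
      (∀ h : AMCenter.czero X, ‖Φ h‖ = ‖h‖) ∧
      (∀ h : AMCenter.czero X, IsGLB {c : ℝ | 0 < c ∧ AMCenter.OpLE (AMCenter.mulOp h) (c • 1) ∧
        AMCenter.OpLE (-AMCenter.mulOp h) (c • 1)} ‖h‖) := by
  refine ⟨AMCenter.mulOpEquiv X, AMCenter.coe_mulOpEquiv, AMCenter.opLE_mulOp_iff,
    fun h k => ⟨?_, ?_⟩, AMCenter.norm_mulOp, AMCenter.isGLB_setOf_opLE⟩
  -- An order isomorphism carries the supremum of a pair to the supremum of its image.
  · have := (AMCenter.mulOpOrderIso X).isLUB_image'.2 (isLUB_pair (a := h) (b := k))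
    rwa [Set.image_pair] at this
  · have := (AMCenter.mulOpOrderIso X).isGLB_image'.2 (isGLB_pair (a := h) (b := k))
    rwa [Set.image_pair] at this
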